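/- Let $\nu$ be a $\sigma$-finite measure and $f_0,f_1$ two probability densities with respect to $\nu$ whose Kullback–Leibler divergences are positive and finite: $$I_0=\int \log\frac{f_0}{f_1}\,f_0\,d\nu\in(0,\infty),\qquad I_1=\int \log\frac{f_1}{f_0}\,f_1\,d\nu\in(0,\infty).$$ For $i\in\{0,1\}$ let $\mathsf P_i$ (with expectation $\mathsf E_i$) be the distribution of an i.i.d. sequence $X=(X_n)_{n\ge 1}$ with density $f_i$, let $\mathsf P_\pi=(1-\pi)\mathsf P_0+\pi\mathsf P_1$ (with expectation $\mathsf E_\pi$) for $\pi\in[0,1]$, and set $\mathcal F_n=\sigma(X_1,\dots,X_n)$ and $\Lambda_n=\sum_{i=1}^n\log\frac{f_1(X_i)}{f_0(X_i)}$. A test is a pair $(T,D)$ of functions of $X$, where $T\in\{1,2,\dots\}\cup\{\infty\}$ and $D$ is a $\{0,1\}$-valued random variable, such that $\{T=n\}\in\mathcal F_n$ and $\{T=n,\,D=i\}\in\mathcal F_n$ for all $n\ge 1$ and $i\in\{0,1\}$. For $\alpha,\beta\in(0,1)$ let $\mathcal E(\alpha,\beta)$ be the class of tests with $\mathsf P_0(D=1)\le\alpha$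 and $\mathsf P_1(D=0)\le\beta$, and let $\mathcal L_\pi(\alpha,\beta)=\inf_{(T,D)\in\mathcal E(\alpha,\beta)}\mathsf E_\pi[T]$. The sequential probability ratio test (SPRT) has stopping time $$\widetilde T(\alpha,\beta)=\inf\{n\ge 1:\Lambda_n\notin(-|\log\beta|,\,|\log\alpha|)\}$$ and decision $\widetilde D(\alpha,\beta)=1\{\Lambda_{\widetilde T(\alpha,\beta)}\ge|\log\alpha|\}$. For every integer $m\ge 1$ let $l_m,u_m$ be integers with $0\le l_m\le u_m\le m$, $u_m>0$ and $l_m<m$, and for $\alpha,\beta\in(0,1)$ put $$\alpha_m=1-(1-\alpha)^{1/(m-l_m)},\qquad \beta_m=1-(1-\beta)^{1/u_m}.$$ Let $\chi^*=\{(T^*(\alpha,\beta),D^*(\alpha,\beta))\in\mathcal E(\alpha,\beta):\ \alpha,\beta\in(0,1)\}$ be a family of tests that is asymptotically optimal in the high-dimensional sense, i.e. for all $\alpha,\beta\in(0,1)$, $$\max_{s\in\{l_m,\dots,u_m\}}\frac{\mathsf E_{s/m}[T^*(\alpha_m,\beta_m)]}{\mathcal L_{s/m}(\alpha_m,\beta_m)}\longrightarrow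 1\qquad(m\to\infty).$$ Write $x_k\lesssim y_k$ for $\limsup_{k\to\infty}(x_k/y_k)\le 1$. Then: (i) If $u_m\not\to\infty$ as $m\to\infty$, there exists a strictly increasing sequence of positive integers $(m_k)$ such that, as $k\to\infty$, $$\mathsf E_0[T^*(\alpha_{m_k},\beta)]\lesssim\mathsf E_0[\widetilde T(\alpha_{m_k},\beta)]\qquad\text{for all }\alpha,\beta\in(0,1).$$ (ii) If $m-l_m\not\to\infty$ as $m\to\infty$, there exists a strictly increasing sequence of positive integers $(m_k)$ such that, as $k\to\infty$, $$\mathsf E_1[T^*(\alpha,\beta_{m_k})]\lesssim\mathsf E_1[\widetilde T(\alpha,\beta_{m_k})]\qquad\text{for all }\alpha,\beta\in(0,1).$$ -/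

import Mathlib

open MeasureTheory Filter Topology
open scoped ENNReal

namespace SharpSPRT

noncomputable section

/-- A pair `(T, D)`: a random time, possibly infinite, and a binary decision, both functions of the
sequence of observations; `D = true` means that the null hypothesis is rejected. -/
abbrev TimeDecision (S : Type*) : Type _ := ((ℕ → S) → ℕ∞) × ((ℕ → S) → Bool)

variable {S : Type*} [MeasurableSpace S]

/-- The distribution of one observation with density `f` with respect to `ν`. -/
def obsLaw (ν : Measure S) (f : S → ℝ) : Measure S :=
  ν.withDensity (fun x => ENNReal.ofReal (f x))

/-- The distribution `P` of an iid sequence of observations with density `f`.  The coordinates of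
`x : ℕ → S` are numbered from `0`: the observation `X_{i+1}` of the sequence is `x i`. -/
def streamLaw (ν : Measure S) (f : S → ℝ) : Measure (ℕ → S) :=
  Measure.infinitePi (fun _ : ℕ => obsLaw ν f)

/-- `f` is a probability density with respect to `ν`. -/
structure IsDensity (ν : Measure S) (f : S → ℝ) : Prop where
  measurable : Measurable f
  nonneg : ∀ x, 0 ≤ f x
  lintegral_eq_one : ∫⁻ x, ENNReal.ofReal (f x) ∂ν = 1

/-- The Kullback-Leibler divergence `∫ log (f / g) f dν` of the density `f` from the density `g`,
with value in `[0, ∞]`. -/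
def klInfo (ν : Measure S) (f g : S → ℝ) : ℝ≥0∞ :=
  InformationTheory.klDiv (obsLaw ν f) (obsLaw ν g)

variable (S) in
/-- The σ-algebra `F_n` generated by the first `n` observations. -/
@[reducible]
def obsSigma (n : ℕ) : MeasurableSpace (ℕ → S) :=
  ⨆ i ∈ Finset.range n, MeasurableSpace.comap (fun x : ℕ → S => x i) inferInstance

/-- The log-likelihood ratio `Λ_n` of the first `n` observations.  (When the divergences between
`f₀` and `f₁` are finite, the points where `f₀` or `f₁` vanishes have probability zero under both
hypotheses.) -/
def logLR (f₀ f₁ : S → ℝ) (n : ℕ) (x : ℕ → S) : ℝ :=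
  ∑ i ∈ Finset.range n, Real.log (f₁ (x i) / f₀ (x i))

/-- `(T, D)` is a sequential test: `T ≥ 1` is a stopping time and `D` is an `F_T`-measurable
Bernoulli random variable. -/
structure IsTest (τ : TimeDecision S) : Prop where
  one_le : ∀ x, 1 ≤ τ.1 x
  stopping : ∀ n : ℕ, 1 ≤ n → MeasurableSet[obsSigma S n] {x | τ.1 x = n}
  measurable_decision : Measurable τ.2
  decision : ∀ n : ℕ, 1 ≤ n → ∀ i : Bool,
    MeasurableSet[obsSigma S n] {x | τ.1 x = n ∧ τ.2 x = i}

/-- The expectation of the sample size `T` of `(T, D)` under `P`, with value in `[0, ∞]`. -/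
def meanTime (P : Measure (ℕ → S)) (τ : TimeDecision S) : ℝ≥0∞ :=
  ∫⁻ x, (τ.1 x : ℝ≥0∞) ∂P

/-- The class `E(α, β)` of tests with type-I error probability at most `α` and type-II error
probability at most `β`. -/
def testClass (ν : Measure S) (f₀ f₁ : S → ℝ) (α β : ℝ) : Set (TimeDecision S) :=
  {τ | IsTest τ ∧ streamLaw ν f₀ {x | τ.2 x = true} ≤ ENNReal.ofReal α ∧
    streamLaw ν f₁ {x | τ.2 x = false} ≤ ENNReal.ofReal β}

/-- The mixture distribution `P_π = (1 - π) P_0 + π P_1`, for `π ∈ [0, 1]`. -/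
def mixLaw (ν : Measure S) (f₀ f₁ : S → ℝ) (π : ℝ) : Measure (ℕ → S) :=
  ENNReal.ofReal (1 - π) • streamLaw ν f₀ + ENNReal.ofReal π • streamLaw ν f₁

/-- The optimal expected sample size `L_π(α, β)` in `E(α, β)` under `P_π`. -/
def optTime (ν : Measure S) (f₀ f₁ : S → ℝ) (π α β : ℝ) : ℝ≥0∞ :=
  ⨅ τ ∈ testClass ν f₀ f₁ α β, meanTime (mixLaw ν f₀ f₁ π) τ

/-- The stopping time `inf {n ≥ 1 : Λ_n ∉ (-B, A)}` of the sequential probability ratio test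
(`∞` if there is no such `n`). -/
def sprtTime (f₀ f₁ : S → ℝ) (A B : ℝ) (x : ℕ → S) : ℕ∞ :=
  ⨅ n ∈ {n : ℕ | 1 ≤ n ∧ logLR f₀ f₁ n x ∉ Set.Ioo (-B) A}, (n : ℕ∞)

open Classical in
/-- The decision `1{Λ_T ≥ A}` of the sequential probability ratio test (`0` if it never stops). -/
def sprtDecision (f₀ f₁ : S → ℝ) (A B : ℝ) (x : ℕ → S) : Bool :=
  decide (sprtTime f₀ f₁ A B x ≠ ⊤ ∧ A ≤ logLR f₀ f₁ (sprtTime f₀ f₁ A B x).toNat x)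

/-- The sequential probability ratio test with thresholds `A = |log α|` and `B = |log β|`. -/
def sprt (f₀ f₁ : S → ℝ) (α β : ℝ) : TimeDecision S :=
  (sprtTime f₀ f₁ |Real.log α| |Real.log β|, sprtDecision f₀ f₁ |Real.log α| |Real.log β|)

/-- A family of tests, one in `E(α, β)` for all `α, β ∈ (0, 1)`. -/
def IsTestFamily (ν : Measure S) (f₀ f₁ : S → ℝ) (χ : ℝ → ℝ → TimeDecision S) : Prop :=
  ∀ α ∈ Set.Ioo (0 : ℝ) 1, ∀ β ∈ Set.Ioo (0 : ℝ) 1, χ α β ∈ testClass ν f₀ f₁ α β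

/-- The level `α_m = 1 - (1 - α)^{1 / (m - l_m)}`. -/
def alphaLevel (l : ℕ → ℕ) (α : ℝ) (m : ℕ) : ℝ :=
  1 - (1 - α) ^ (1 / ((m : ℝ) - (l m : ℝ)))

/-- The level `β_m = 1 - (1 - β)^{1 / u_m}`. -/
def betaLevel (u : ℕ → ℕ) (β : ℝ) (m : ℕ) : ℝ :=
  1 - (1 - β) ^ (1 / (u m : ℝ))

/-- Asymptotic optimality of a family of tests in the high-dimensional sense: for all
`α, β ∈ (0, 1)`, the maximum over `s ∈ {l_m, …, u_m}` of
`E_{s/m}[T*(α_m, β_m)] / L_{s/m}(α_m, β_m)` tends to `1` as `m → ∞`. -/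
def IsAsympOptimalHD (ν : Measure S) (f₀ f₁ : S → ℝ) (l u : ℕ → ℕ)
    (χ : ℝ → ℝ → TimeDecision S) : Prop :=
  ∀ α ∈ Set.Ioo (0 : ℝ) 1, ∀ β ∈ Set.Ioo (0 : ℝ) 1,
    Tendsto (fun m : ℕ => ⨆ s ∈ Finset.Icc (l m) (u m),
      meanTime (mixLaw ν f₀ f₁ ((s : ℝ) / (m : ℝ))) (χ (alphaLevel l α m) (betaLevel u β m)) /
        optTime ν f₀ f₁ ((s : ℝ) / (m : ℝ)) (alphaLevel l α m) (betaLevel u β m))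
      atTop (𝓝 1)

/-- `x_k ≲ y_k`, i.e. `limsup (x_k / y_k) ≤ 1`. -/
def AsympLE (x y : ℕ → ℝ≥0∞) : Prop :=
  limsup (fun k => x k / y k) atTop ≤ 1

end

end SharpSPRT

/-!
Suppose `u_m = v` along a subsequence.  Then `β_m` is a constant level, and at `s = u_m` the mixture
`P_{s/m}` gives `P_1` only the weight `v / m`.  Chernoff's bound with exponent `-1/2`, whose moment
generating function is the Hellinger affinity `∫ √(f₀ f₁) dν < 1`, gives
`E_1[SPRT] ≤ C α_m^{-1/2}`, which is `O(√m)` because `α_m ≥ α / m`.  So `P_1` contributes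
`O(m^{-1/2})` to the expected sample size of the SPRT under `P_{s/m}`.  By Ville's inequality for
the likelihood ratio martingale the SPRT belongs to `E(α, β)`, hence it bounds `L_{s/m}` from above,
and optimality of `T*` at `s = u_m` becomes a comparison of expectations under `P_0`.  Exchanging
the two hypotheses, with `s = l_m` in place of `s = u_m`, gives the second part.
-/

namespace SharpSPRT

open ProbabilityTheory
open scoped NNReal

section General

variable {Ω : Type*} {mΩ : MeasurableSpace Ω} {μ : Measure Ω}

theorem martingale_prod_of_iIndepFun {X : ℕ → Ω → ℝ} (hmeas : ∀ i, StronglyMeasurable (X i))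
    (hint : ∀ i, Integrable (X i) μ) (hindep : iIndepFun X μ) (hmean : ∀ i, μ[X i] = 1) :
    Martingale (fun n => ∏ i ∈ Finset.range (n + 1), X i) (Filtration.natural X hmeas) μ := by
  have := hindep.isProbabilityMeasure
  have hadapted : ∀ n, StronglyMeasurable[Filtration.natural X hmeas n]
      (∏ i ∈ Finset.range (n + 1), X i) := fun n =>
    Finset.stronglyMeasurable_prod _ fun i hi =>
      (Filtration.stronglyAdapted_natural hmeas i).mono
        ((Filtration.natural X hmeas).mono (Finset.mem_range_succ_iff.1 hi))
  have hintegrable : ∀ n, Integrable (∏ i ∈ Finset.range n, X i) μ := by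
    intro n
    induction n with
    | zero => exact integrable_const (1 : ℝ)
    | succ n ih =>
      rw [Finset.prod_range_succ]
      exact (hindep.indepFun_finsetProd_of_notMem (fun i => (hmeas i).measurable)
        Finset.notMem_range_self).integrable_mul ih (hint n)
  refine martingale_nat hadapted (fun n => hintegrable (n + 1)) fun n => ?_
  have hpull := condExp_mul_of_stronglyMeasurable_left (hadapted n)
    (by simpa only [← Finset.prod_range_succ] using hintegrable (n + 2)) (hint (n + 1))
  filter_upwards [hpull, hindep.condExp_natural_ae_eq_of_lt hmeas n.lt_succ_self]
    with ω hω hmean_next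
  rw [Finset.prod_range_succ _ (n + 1), hω, Pi.mul_apply, hmean_next, hmean, mul_one]

theorem mul_measure_exists_le_le_of_martingale [IsFiniteMeasure μ] {𝒢 : Filtration ℕ mΩ}
    {M : ℕ → Ω → ℝ} (hM : Martingale M 𝒢 μ) (hnonneg : 0 ≤ M) (c : ℝ≥0) :
    c * μ {ω | ∃ n, (c : ℝ) ≤ M n ω} ≤ ENNReal.ofReal μ[M 0] := by
  let E : ℕ → Set Ω := fun n =>
    {ω | (c : ℝ) ≤ (Finset.range (n + 1)).sup' Finset.nonempty_range_add_one fun k => M k ω}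
  have mem_E : ∀ n ω, ω ∈ E n ↔ ∃ k ≤ n, (c : ℝ) ≤ M k ω := fun n ω => by
    simp only [E, Set.mem_ofPred_eq, Finset.le_sup'_iff, Finset.mem_range_succ_iff]
  have hE : Monotone E := fun i j hij ω hω => by
    obtain ⟨k, hk, hck⟩ := (mem_E i ω).1 hω
    exact (mem_E j ω).2 ⟨k, hk.trans hij, hck⟩
  have hunion : {ω | ∃ n, (c : ℝ) ≤ M n ω} = ⋃ n, E n := by
    ext ω
    simp only [Set.mem_ofPred_eq, Set.mem_iUnion, mem_E]
    exact ⟨fun ⟨n, hn⟩ => ⟨n, n, le_rfl, hn⟩, fun ⟨_, k, _, hk⟩ => ⟨k, hk⟩⟩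
  rw [hunion, hE.measure_iUnion, ENNReal.mul_iSup]
  refine iSup_le fun n => (maximal_ineq hM.submartingale hnonneg n).trans
    (ENNReal.ofReal_le_ofReal ?_)
  calc ∫ ω in E n, M n ω ∂μ ≤ ∫ ω, M n ω ∂μ :=
        setIntegral_le_integral (hM.integrable n) (ae_of_all _ (hnonneg n))
    _ = μ[M 0] := by simpa using (hM.setIntegral_eq n.zero_le MeasurableSet.univ).symm

theorem tsum_indicator_lt (t : ℕ∞) :
    ∑' n : ℕ, {n : ℕ | (n : ℕ∞) < t}.indicator 1 n = (t : ℝ≥0∞) := by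
  rw [← tsum_subtype]
  simp only [Pi.one_apply, ENNReal.tsum_set_one]
  induction t using ENat.recTopCoe with
  | top => simp
  | coe k =>
    have hrange : {n : ℕ | (n : ℕ∞) < k} = Finset.range k := by ext; simp
    rw [hrange, Set.encard_coe_eq_coe_finsetCard, Finset.card_range]

theorem lintegral_toENNReal_le_tsum_measure {T : Ω → ℕ∞} {E : ℕ → Set Ω}
    (hE : ∀ n, MeasurableSet (E n)) (hT : ∀ ω, ∀ n : ℕ, n < T ω → ω ∈ E n) :
    ∫⁻ ω, T ω ∂μ ≤ ∑' n, μ (E n) :=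
  calc ∫⁻ ω, T ω ∂μ = ∫⁻ ω, ∑' n : ℕ, {n : ℕ | (n : ℕ∞) < T ω}.indicator 1 n ∂μ := by
        simp only [tsum_indicator_lt]
    _ ≤ ∫⁻ ω, ∑' n, (E n).indicator 1 ω ∂μ :=
        lintegral_mono fun ω => ENNReal.tsum_le_tsum fun n => Set.indicator_le
          (fun n hn => (Set.indicator_of_mem (hT ω n hn) (1 : Ω → ℝ≥0∞)).ge) n
    _ = ∑' n, μ (E n) := by
        rw [lintegral_tsum fun n => (measurable_one.indicator (hE n)).aemeasurable]
        exact tsum_congr fun n => lintegral_indicator_one (hE n)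

theorem lintegral_toENNReal_le_of_partialSum_le {X : ℕ → Ω → ℝ} (hmeas : ∀ i, Measurable (X i))
    (hindep : iIndepFun X μ) (hident : ∀ i, IdentDistrib (X i) (X 0) μ μ) {t : ℝ} (ht : t ≤ 0)
    (hint : Integrable (fun ω => Real.exp (t * X 0 ω)) μ) (hmgf : mgf (X 0) μ t < 1)
    {T : Ω → ℕ∞} {A : ℝ} (hT : ∀ ω, ∀ n : ℕ, n < T ω → ∑ i ∈ Finset.range n, X i ω ≤ A) :
    ∫⁻ ω, T ω ∂μ ≤ ENNReal.ofReal (Real.exp (-t * A) / (1 - mgf (X 0) μ t)) := by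
  have := hindep.isProbabilityMeasure
  have hmgf_nonneg : 0 ≤ mgf (X 0) μ t := mgf_nonneg
  have chernoff : ∀ n, μ {ω | ∑ i ∈ Finset.range n, X i ω ≤ A} ≤
      ENNReal.ofReal (Real.exp (-t * A) * mgf (X 0) μ t ^ n) := by
    intro n
    have hint_sum : Integrable (fun ω => Real.exp (t * (∑ i ∈ Finset.range n, X i) ω)) μ :=
      hindep.integrable_exp_mul_sum hmeas fun i _ =>
        ((hident i).comp (u := fun x => Real.exp (t * x)) (by fun_prop)).integrable_iff.2 hint
    have hmgf_sum : mgf (∑ i ∈ Finset.range n, X i) μ t = mgf (X 0) μ t ^ n := by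
      rw [hindep.mgf_sum hmeas,
        Finset.prod_congr rfl fun i _ => mgf_congr_of_identDistrib (X i) (X 0) (hident i) t,
        Finset.prod_const, Finset.card_range]
    rw [← ofReal_measureReal, ← hmgf_sum]
    simpa only [Finset.sum_apply] using
      ENNReal.ofReal_le_ofReal (measure_le_le_exp_mul_mgf A ht hint_sum)
  calc ∫⁻ ω, T ω ∂μ ≤ ∑' n, μ {ω | ∑ i ∈ Finset.range n, X i ω ≤ A} :=
        lintegral_toENNReal_le_tsum_measure
          (fun n => measurableSet_le (by fun_prop) measurable_const) hT
    _ ≤ ∑' n, ENNReal.ofReal (Real.exp (-t * A) * mgf (X 0) μ t ^ n) :=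
        ENNReal.tsum_le_tsum chernoff
    _ = ENNReal.ofReal (Real.exp (-t * A) / (1 - mgf (X 0) μ t)) := by
        rw [← ENNReal.ofReal_tsum_of_nonneg (fun n => by positivity)
          ((summable_geometric_of_lt_one hmgf_nonneg hmgf).mul_left _), tsum_mul_left,
          tsum_geometric_of_lt_one hmgf_nonneg hmgf, div_eq_mul_inv]

theorem integral_lt_one_of_integral_sq_eq_one [IsProbabilityMeasure μ] {Z : Ω → ℝ}
    (hZ : MemLp Z 2 μ) (hsq : ∫ ω, Z ω ^ 2 ∂μ = 1) (hne : ¬ Z =ᵐ[μ] 1) : ∫ ω, Z ω ∂μ < 1 := by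
  have hZ1 := hZ.integrable one_le_two
  have hvar : Integrable (fun ω => (Z ω - 1) ^ 2) μ := (hZ.sub (memLp_const 1)).integrable_sq
  have hexpand : ∫ ω, (Z ω - 1) ^ 2 ∂μ = 2 * (1 - ∫ ω, Z ω ∂μ) := by
    have hlin : Integrable (fun ω => 2 * Z ω - 1) μ :=
      (hZ1.const_mul 2).sub (integrable_const 1)
    have hsplit : ∀ ω, (Z ω - 1) ^ 2 = Z ω ^ 2 - (2 * Z ω - 1) := fun ω => by ring
    simp only [hsplit]
    rw [integral_sub hZ.integrable_sq hlin,
      integral_sub (hZ1.const_mul 2) (integrable_const 1), integral_const_mul, hsq]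
    simp only [integral_const, probReal_univ, smul_eq_mul]
    ring
  have hpos : 0 < ∫ ω, (Z ω - 1) ^ 2 ∂μ := by
    refine (integral_nonneg fun ω => sq_nonneg _).lt_of_ne' fun h0 => hne ?_
    filter_upwards [(integral_eq_zero_iff_of_nonneg (fun ω => sq_nonneg _) hvar).1 h0] with ω hω
    simpa [sub_eq_zero] using hω
  linarith

end General

theorem sq_exp_neg_half_mul_log_div (a b : ℝ) :
    Real.exp (-1 / 2 * Real.log (a / b)) ^ 2 = Real.exp (Real.log (b / a)) := by
  rw [← Real.exp_nat_mul, ← inv_div a, Real.log_inv]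
  congr 1
  push_cast
  ring

section Observations

variable {S : Type*} [MeasurableSpace S] {ν : Measure S} {f g : S → ℝ}

theorem IsDensity.isProbabilityMeasure_obsLaw (hf : IsDensity ν f) :
    IsProbabilityMeasure (obsLaw ν f) :=
  ⟨by rw [obsLaw, withDensity_apply _ MeasurableSet.univ, setLIntegral_univ, hf.lintegral_eq_one]⟩

theorem IsDensity.isProbabilityMeasure_streamLaw (hf : IsDensity ν f) :
    IsProbabilityMeasure (streamLaw ν f) := by
  have := hf.isProbabilityMeasure_obsLaw
  unfold streamLaw
  infer_instance

theorem IsDensity.ae_eq_zero_of_absolutelyContinuous (hf : IsDensity ν f) (hg : IsDensity ν g)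
    (hac : obsLaw ν f ≪ obsLaw ν g) : ∀ᵐ x ∂ν, g x = 0 → f x = 0 := by
  have hg_ne : ∀ᵐ x ∂obsLaw ν g, g x ≠ 0 :=
    (ae_withDensity_iff hg.measurable.ennreal_ofReal).2 <| ae_of_all _ fun x hx hgx =>
      hx (by rw [hgx, ENNReal.ofReal_zero])
  filter_upwards [(ae_withDensity_iff hf.measurable.ennreal_ofReal).1 (hac.ae_le hg_ne)]
    with x hx hgx
  by_contra hfx
  exact hx (ENNReal.ofReal_pos.2 ((hf.nonneg x).lt_of_ne' hfx)).ne' hgx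

/-- `f` and `g` are densities of two mutually absolutely continuous distributions.  This is what
makes the likelihood ratio `g / f` well defined almost surely under both. -/
structure AreEquivalentDensities (ν : Measure S) (f g : S → ℝ) : Prop where
  left : IsDensity ν f
  right : IsDensity ν g
  ac : obsLaw ν f ≪ obsLaw ν g
  ac_symm : obsLaw ν g ≪ obsLaw ν f

namespace AreEquivalentDensities

theorem symm (h : AreEquivalentDensities ν f g) : AreEquivalentDensities ν g f :=
  ⟨h.right, h.left, h.ac_symm, h.ac⟩

-- With `exp (log (g / f))` in place of `g / f`, products over the sample are exactly `exp Λ_n`,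
-- also at the points where a density vanishes.
theorem ae_mul_exp_log_div (h : AreEquivalentDensities ν f g) :
    ∀ᵐ x ∂ν, f x * Real.exp (Real.log (g x / f x)) = g x := by
  filter_upwards [h.left.ae_eq_zero_of_absolutelyContinuous h.right h.ac,
    h.right.ae_eq_zero_of_absolutelyContinuous h.left h.ac_symm] with x hfx hgx
  rcases (h.left.nonneg x).eq_or_lt' with hf | hf
  · rw [hf, hgx hf, zero_mul]
  · have hg : 0 < g x := (h.right.nonneg x).lt_of_ne' fun hg => hf.ne' (hfx hg)
    rw [Real.exp_log (by positivity), mul_div_cancel₀ _ hf.ne']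

theorem measurable_log_div (h : AreEquivalentDensities ν f g) :
    Measurable fun x => Real.log (g x / f x) :=
  (h.right.measurable.div h.left.measurable).log

theorem lintegral_exp_log_div (h : AreEquivalentDensities ν f g) :
    ∫⁻ x, ENNReal.ofReal (Real.exp (Real.log (g x / f x))) ∂obsLaw ν f = 1 := by
  rw [obsLaw, lintegral_withDensity_eq_lintegral_mul _ h.left.measurable.ennreal_ofReal
    h.measurable_log_div.exp.ennreal_ofReal, ← h.right.lintegral_eq_one]
  refine lintegral_congr_ae ?_
  filter_upwards [h.ae_mul_exp_log_div] with x hx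
  rw [Pi.mul_apply, ← ENNReal.ofReal_mul (h.left.nonneg x), hx]

theorem integrable_exp_log_div (h : AreEquivalentDensities ν f g) :
    Integrable (fun x => Real.exp (Real.log (g x / f x))) (obsLaw ν f) :=
  (lintegral_ofReal_ne_top_iff_integrable h.measurable_log_div.exp.aestronglyMeasurable
    (ae_of_all _ fun _ => (Real.exp_pos _).le)).1
    (h.lintegral_exp_log_div.trans_ne ENNReal.one_ne_top)

theorem integral_exp_log_div (h : AreEquivalentDensities ν f g) :
    ∫ x, Real.exp (Real.log (g x / f x)) ∂obsLaw ν f = 1 := by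
  rw [integral_eq_lintegral_of_nonneg_ae (ae_of_all _ fun _ => (Real.exp_pos _).le)
    h.measurable_log_div.exp.aestronglyMeasurable, h.lintegral_exp_log_div, ENNReal.toReal_one]

theorem obsLaw_eq_of_ae_log_div_eq_zero (h : AreEquivalentDensities ν f g)
    (hlog : ∀ᵐ x ∂obsLaw ν g, Real.log (g x / f x) = 0) : obsLaw ν f = obsLaw ν g := by
  refine withDensity_congr_ae ?_
  filter_upwards [(ae_withDensity_iff h.right.measurable.ennreal_ofReal).1 hlog,
    h.ae_mul_exp_log_div] with x hlogx hx
  have hlog0 : Real.log (g x / f x) = 0 := by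
    by_cases hg : g x = 0
    · simp only [hg, zero_div, Real.log_zero]
    · exact hlogx (ENNReal.ofReal_pos.2 ((h.right.nonneg x).lt_of_ne' hg)).ne'
  rw [hlog0, Real.exp_zero, mul_one] at hx
  rw [hx]

end AreEquivalentDensities

/-- The Hellinger affinity `∫ √(f g) dν` of two equivalent densities, written as the moment
generating function at `-1/2` of the log-likelihood ratio `log (g / f)` under `g`. -/
noncomputable def hellingerAffinity (ν : Measure S) (f g : S → ℝ) : ℝ :=
  mgf (fun x => Real.log (g x / f x)) (obsLaw ν g) (-1 / 2)

namespace AreEquivalentDensities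

theorem memLp_exp_neg_half_log_div (h : AreEquivalentDensities ν f g) :
    MemLp (fun x => Real.exp (-1 / 2 * Real.log (g x / f x))) 2 (obsLaw ν g) := by
  rw [memLp_two_iff_integrable_sq (h.measurable_log_div.const_mul _).exp.aestronglyMeasurable]
  simpa only [sq_exp_neg_half_mul_log_div] using h.symm.integrable_exp_log_div

theorem hellingerAffinity_lt_one (h : AreEquivalentDensities ν f g)
    (hne : obsLaw ν f ≠ obsLaw ν g) : hellingerAffinity ν f g < 1 := by
  have := h.right.isProbabilityMeasure_obsLaw
  refine integral_lt_one_of_integral_sq_eq_one h.memLp_exp_neg_half_log_div ?_ fun hone =>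
    hne (h.obsLaw_eq_of_ae_log_div_eq_zero ?_)
  · simpa only [sq_exp_neg_half_mul_log_div] using h.symm.integral_exp_log_div
  · filter_upwards [hone] with x hx
    simpa using hx

end AreEquivalentDensities

end Observations

theorem logLR_swap {S : Type*} (f g : S → ℝ) (n : ℕ) (x : ℕ → S) :
    logLR g f n x = -logLR f g n x := by
  simp only [logLR, ← Finset.sum_neg_distrib, ← Real.log_inv, inv_div]

section LogLikelihood

variable {S : Type*} [MeasurableSpace S] {ν : Measure S} {f g : S → ℝ}

theorem IsDensity.iIndepFun_comp_eval (hf : IsDensity ν f) {φ : S → ℝ} (hφ : Measurable φ) :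
    iIndepFun (fun (i : ℕ) (x : ℕ → S) => φ (x i)) (streamLaw ν f) := by
  have := hf.isProbabilityMeasure_obsLaw
  exact iIndepFun_infinitePi fun _ => hφ

theorem IsDensity.identDistrib_comp_eval (hf : IsDensity ν f) {φ : S → ℝ} (hφ : Measurable φ)
    (i : ℕ) : IdentDistrib (fun x : ℕ → S => φ (x i)) φ (streamLaw ν f) (obsLaw ν f) where
  aemeasurable_fst := (hφ.comp (measurable_pi_apply i)).aemeasurable
  aemeasurable_snd := hφ.aemeasurable
  map_eq := by
    have := hf.isProbabilityMeasure_obsLaw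
    rw [← (measurePreserving_eval_infinitePi (fun _ : ℕ => obsLaw ν f) i).map_eq,
      Measure.map_map hφ (measurable_pi_apply i)]
    rfl

theorem measurable_obsSigma_logLR (hf : Measurable f) (hg : Measurable g) {k n : ℕ} (hkn : k ≤ n) :
    Measurable[obsSigma S n] (logLR f g k) := by
  refine Finset.measurable_fun_sum _ fun i hi => (hg.div hf).log.comp ?_
  exact (comap_measurable _).mono
    (le_iSup₂_of_le (f := fun i (_ : i ∈ Finset.range n) =>
      MeasurableSpace.comap (fun x : ℕ → S => x i) inferInstance) i
      (Finset.range_mono hkn hi) le_rfl) le_rfl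

theorem obsSigma_le (n : ℕ) : obsSigma S n ≤ MeasurableSpace.pi :=
  iSup₂_le fun i _ => (measurable_pi_apply i).comap_le

namespace AreEquivalentDensities

theorem streamLaw_exists_le_logLR_le (h : AreEquivalentDensities ν f g) (A : ℝ) :
    streamLaw ν f {x | ∃ n, 1 ≤ n ∧ A ≤ logLR f g n x} ≤ ENNReal.ofReal (Real.exp (-A)) := by
  let ratio : S → ℝ := fun y => Real.exp (Real.log (g y / f y))
  have hratio : Measurable ratio := h.measurable_log_div.exp
  have hident := h.left.identDistrib_comp_eval hratio
  have := h.left.isProbabilityMeasure_streamLaw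
  have hmart := martingale_prod_of_iIndepFun (X := fun (i : ℕ) (x : ℕ → S) => ratio (x i))
    (fun i => (hratio.comp (measurable_pi_apply i)).stronglyMeasurable)
    (fun i => (hident i).integrable_iff.2 h.integrable_exp_log_div)
    (h.left.iIndepFun_comp_eval hratio)
    (fun i => (hident i).integral_eq.trans h.integral_exp_log_div)
  have hprod : ∀ n x, (∏ i ∈ Finset.range n, fun x : ℕ → S => ratio (x i)) x =
      Real.exp (logLR f g n x) := fun n x => by
    simp only [Finset.prod_apply, ratio, logLR, Real.exp_sum]
  have hmean : ∫ x, (∏ i ∈ Finset.range (0 + 1), fun x : ℕ → S => ratio (x i)) x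
      ∂streamLaw ν f = 1 := by
    simpa using (hident 0).integral_eq.trans h.integral_exp_log_div
  have hville := mul_measure_exists_le_le_of_martingale hmart
    (fun n x => (Real.exp_pos _).le.trans_eq (hprod (n + 1) x).symm) (Real.exp A).toNNReal
  rw [hmean, ENNReal.ofReal_one, Real.coe_toNNReal _ (Real.exp_pos A).le] at hville
  simp only [hprod, Real.exp_le_exp] at hville
  have hsub : {x | ∃ n, 1 ≤ n ∧ A ≤ logLR f g n x} ⊆ {x | ∃ n, A ≤ logLR f g (n + 1) x} :=
    fun x ⟨n, hn, hA⟩ => ⟨n - 1, by rwa [Nat.sub_add_cancel hn]⟩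
  rw [Real.exp_neg, ENNReal.ofReal_inv_of_pos (Real.exp_pos A)]
  exact (measure_mono hsub).trans (ENNReal.le_inv_iff_mul_le.2 (by rwa [mul_comm]))

theorem lintegral_toENNReal_le_of_logLR_le (h : AreEquivalentDensities ν f g)
    (hne : obsLaw ν f ≠ obsLaw ν g) {T : (ℕ → S) → ℕ∞} {A : ℝ}
    (hT : ∀ x, ∀ n : ℕ, n < T x → logLR f g n x ≤ A) :
    ∫⁻ x, T x ∂streamLaw ν g ≤
      ENNReal.ofReal (Real.exp (A / 2) / (1 - hellingerAffinity ν f g)) := by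
  have := h.right.isProbabilityMeasure_obsLaw
  have hlog := h.measurable_log_div
  have hident := h.right.identDistrib_comp_eval hlog
  have hmgf : mgf (fun x : ℕ → S => Real.log (g (x 0) / f (x 0))) (streamLaw ν g) (-1 / 2) =
      hellingerAffinity ν f g := mgf_congr_of_identDistrib _ _ (hident 0) _
  have hint : Integrable (fun x : ℕ → S => Real.exp (-1 / 2 * Real.log (g (x 0) / f (x 0))))
      (streamLaw ν g) :=
    (h.right.identDistrib_comp_eval (hlog.const_mul (-1 / 2)).exp 0).integrable_iff.2
      (h.memLp_exp_neg_half_log_div.integrable one_le_two)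
  have hbound := lintegral_toENNReal_le_of_partialSum_le
    (X := fun (i : ℕ) (x : ℕ → S) => Real.log (g (x i) / f (x i)))
    (fun i => hlog.comp (measurable_pi_apply i)) (h.right.iIndepFun_comp_eval hlog)
    (fun i => (hident i).trans (hident 0).symm) (by norm_num) hint
    (hmgf.trans_lt (h.hellingerAffinity_lt_one hne)) hT
  rwa [hmgf, show -(-1 / 2) * A = A / 2 by ring] at hbound

end AreEquivalentDensities

end LogLikelihood

section SprtPaths

variable {S : Type*} {f g : S → ℝ} {A B : ℝ} {x : ℕ → S} {n : ℕ}

theorem sprtTime_swap (f g : S → ℝ) (A B : ℝ) (x : ℕ → S) :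
    sprtTime g f B A x = sprtTime f g A B x := by
  have hexit : ∀ n, logLR g f n x ∈ Set.Ioo (-A) B ↔ logLR f g n x ∈ Set.Ioo (-B) A := fun n => by
    rw [logLR_swap f g, Set.neg_mem_Ioo_iff, neg_neg]
  simp only [sprtTime, hexit]

theorem one_le_sprtTime (f g : S → ℝ) (A B : ℝ) (x : ℕ → S) : 1 ≤ sprtTime f g A B x :=
  le_iInf₂ fun _ hn => Nat.one_le_cast.2 hn.1

theorem mem_Ioo_of_lt_sprtTime (hn : 1 ≤ n) (h : n < sprtTime f g A B x) :
    logLR f g n x ∈ Set.Ioo (-B) A := by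
  by_contra hexit
  exact h.not_ge (iInf₂_le n ⟨hn, hexit⟩)

theorem logLR_le_of_lt_sprtTime (hA : 0 ≤ A) (h : n < sprtTime f g A B x) :
    logLR f g n x ≤ A := by
  rcases n.eq_zero_or_pos with rfl | hn
  · simpa only [logLR, Finset.range_zero, Finset.sum_empty] using hA
  · exact (mem_Ioo_of_lt_sprtTime hn h).2.le

theorem exists_sprtTime_eq (h : sprtTime f g A B x ≠ ⊤) :
    ∃ n : ℕ, 1 ≤ n ∧ sprtTime f g A B x = n ∧ logLR f g n x ∉ Set.Ioo (-B) A := by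
  rw [sprtTime, ← sInf_image] at h ⊢
  have hexits : ((↑) '' {n : ℕ | 1 ≤ n ∧ logLR f g n x ∉ Set.Ioo (-B) A} : Set ℕ∞).Nonempty :=
    Set.nonempty_iff_ne_empty.2 fun hempty => h (by rw [hempty, sInf_empty])
  obtain ⟨n, ⟨hn, hexit⟩, heq⟩ := csInf_mem hexits
  exact ⟨n, hn, heq.symm, hexit⟩

theorem sprtTime_eq_iff (hn : 1 ≤ n) :
    sprtTime f g A B x = n ↔ logLR f g n x ∉ Set.Ioo (-B) A ∧
      ∀ k ∈ Finset.Ico 1 n, logLR f g k x ∈ Set.Ioo (-B) A := by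
  constructor
  · intro h
    obtain ⟨k, -, hk, hexit⟩ := exists_sprtTime_eq (h.trans_ne (ENat.natCast_ne_top n))
    obtain rfl : k = n := Nat.cast_injective (hk.symm.trans h)
    refine ⟨hexit, fun j hj => mem_Ioo_of_lt_sprtTime (Finset.mem_Ico.1 hj).1 ?_⟩
    rw [h]
    exact Nat.cast_lt.2 (Finset.mem_Ico.1 hj).2
  · rintro ⟨hexit, hinside⟩
    refine le_antisymm (iInf₂_le n ⟨hn, hexit⟩) (le_iInf₂ fun k hk => ?_)
    by_contra! hkn
    exact hk.2 (hinside k (Finset.mem_Ico.2 ⟨hk.1, Nat.cast_lt.1 hkn⟩))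

theorem sprtDecision_eq_true_iff :
    sprtDecision f g A B x = true ↔
      ∃ n : ℕ, 1 ≤ n ∧ sprtTime f g A B x = n ∧ A ≤ logLR f g n x := by
  rw [sprtDecision, decide_eq_true_iff]
  constructor
  · rintro ⟨hT, hA⟩
    obtain ⟨n, hn, heq, -⟩ := exists_sprtTime_eq hT
    rw [heq, ENat.toNat_natCast] at hA
    exact ⟨n, hn, heq, hA⟩
  · rintro ⟨n, -, heq, hA⟩
    rw [heq, ENat.toNat_natCast]
    exact ⟨ENat.natCast_ne_top n, hA⟩

theorem exists_logLR_le_of_sprtDecision_eq_false (hD : sprtDecision f g A B x = false)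
    (hT : sprtTime f g A B x ≠ ⊤) : ∃ n : ℕ, 1 ≤ n ∧ logLR f g n x ≤ -B := by
  obtain ⟨n, hn, heq, hexit⟩ := exists_sprtTime_eq hT
  refine ⟨n, hn, not_lt.1 fun hB => hexit ⟨hB, not_le.1 fun hA => ?_⟩⟩
  exact Bool.false_ne_true (hD.symm.trans (sprtDecision_eq_true_iff.2 ⟨n, hn, heq, hA⟩))

end SprtPaths

theorem exp_neg_abs_log {a : ℝ} (ha : a ∈ Set.Ioo (0 : ℝ) 1) : Real.exp (-|Real.log a|) = a := by
  rw [abs_of_neg (Real.log_neg ha.1 ha.2), neg_neg, Real.exp_log ha.1]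

theorem exp_half_abs_log {a : ℝ} (ha : a ∈ Set.Ioo (0 : ℝ) 1) :
    Real.exp (|Real.log a| / 2) = √(a⁻¹) := by
  rw [Real.exp_half, ← neg_neg |Real.log a|, Real.exp_neg, exp_neg_abs_log ha]

section SprtTest

variable {S : Type*} [MeasurableSpace S] {ν : Measure S} {f g : S → ℝ}

theorem IsTest.measurable_time {τ : TimeDecision S} (hτ : IsTest τ) : Measurable τ.1 := by
  refine ENat.measurable_iff.2 fun n => ?_
  rcases n.eq_zero_or_pos with rfl | hn
  · have hempty : τ.1 ⁻¹' {((0 : ℕ) : ℕ∞)} = ∅ :=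
      Set.eq_empty_of_forall_notMem fun x hx =>
        (one_pos.trans_le (hτ.one_le x)).ne' (by simpa using hx)
    rw [hempty]
    exact MeasurableSet.empty
  · exact obsSigma_le n _ (hτ.stopping n hn)

theorem one_le_meanTime (P : Measure (ℕ → S)) [IsProbabilityMeasure P] {τ : TimeDecision S}
    (hτ : IsTest τ) : 1 ≤ meanTime P τ := by
  rw [← measure_univ (μ := P), ← lintegral_one]
  exact lintegral_mono fun x => by simpa using ENat.toENNReal_le.2 (hτ.one_le x)

theorem meanTime_mixLaw (ν : Measure S) (f g : S → ℝ) (p : ℝ) (τ : TimeDecision S) :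
    meanTime (mixLaw ν f g p) τ = ENNReal.ofReal (1 - p) * meanTime (streamLaw ν f) τ +
      ENNReal.ofReal p * meanTime (streamLaw ν g) τ := by
  simp only [meanTime, mixLaw, lintegral_add_measure, lintegral_smul_measure, smul_eq_mul]

theorem mixLaw_swap (ν : Measure S) (f g : S → ℝ) (p : ℝ) :
    mixLaw ν g f p = mixLaw ν f g (1 - p) := by
  rw [mixLaw, mixLaw, sub_sub_cancel, add_comm]

theorem meanTime_sprt_swap (P : Measure (ℕ → S)) (f g : S → ℝ) (α β : ℝ) :
    meanTime P (sprt g f β α) = meanTime P (sprt f g α β) := by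
  simp only [meanTime, sprt, sprtTime_swap f g]

theorem measurableSet_sprtTime_eq (hf : Measurable f) (hg : Measurable g) (A B : ℝ) {n : ℕ}
    (hn : 1 ≤ n) : MeasurableSet[obsSigma S n] {x | sprtTime f g A B x = n} := by
  have hset : {x | sprtTime f g A B x = n} = {x | logLR f g n x ∈ (Set.Ioo (-B) A)ᶜ} ∩
      ⋂ k ∈ Finset.Ico 1 n, {x | logLR f g k x ∈ Set.Ioo (-B) A} := by
    ext x
    simp only [Set.mem_ofPred_eq, sprtTime_eq_iff hn, Set.mem_inter_iff, Set.mem_iInter,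
      Set.mem_compl_iff]
  rw [hset]
  exact MeasurableSet.inter (measurable_obsSigma_logLR hf hg le_rfl measurableSet_Ioo.compl)
    (Finset.measurableSet_biInter _ fun k hk =>
      measurable_obsSigma_logLR hf hg (Finset.mem_Ico.1 hk).2.le measurableSet_Ioo)

theorem measurableSet_sprtTime_eq_and_sprtDecision (hf : Measurable f) (hg : Measurable g)
    (A B : ℝ) {n : ℕ} (hn : 1 ≤ n) (i : Bool) :
    MeasurableSet[obsSigma S n] {x | sprtTime f g A B x = n ∧ sprtDecision f g A B x = i} := by
  have hT := measurableSet_sprtTime_eq hf hg A B hn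
  have hA : MeasurableSet[obsSigma S n] {x | logLR f g n x ∈ Set.Ici A} :=
    measurable_obsSigma_logLR hf hg le_rfl measurableSet_Ici
  have hiff : ∀ x, sprtTime f g A B x = n →
      (sprtDecision f g A B x = true ↔ A ≤ logLR f g n x) := fun x hTx => by
    rw [sprtDecision_eq_true_iff]
    refine ⟨fun ⟨k, _, hk, hA⟩ => ?_, fun hA => ⟨n, hn, hTx, hA⟩⟩
    rwa [Nat.cast_injective (hTx.symm.trans hk)]
  cases i with
  | true =>
    have hset : {x | sprtTime f g A B x = n ∧ sprtDecision f g A B x = true} =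
        {x | sprtTime f g A B x = n} ∩ {x | logLR f g n x ∈ Set.Ici A} :=
      Set.ext fun x => and_congr_right (hiff x)
    rw [hset]
    exact hT.inter hA
  | false =>
    have hset : {x | sprtTime f g A B x = n ∧ sprtDecision f g A B x = false} =
        {x | sprtTime f g A B x = n} \ {x | logLR f g n x ∈ Set.Ici A} :=
      Set.ext fun x => and_congr_right fun hTx =>
        Bool.not_eq_true _ ▸ not_congr (hiff x hTx)
    rw [hset]
    exact hT.diff hA

theorem isTest_sprt (hf : Measurable f) (hg : Measurable g) (α β : ℝ) :
    IsTest (sprt f g α β) where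
  one_le := one_le_sprtTime f g _ _
  stopping _ hn := measurableSet_sprtTime_eq hf hg _ _ hn
  decision _ hn i := measurableSet_sprtTime_eq_and_sprtDecision hf hg _ _ hn i
  measurable_decision := by
    refine measurable_to_bool ?_
    have hset : (sprt f g α β).2 ⁻¹' {true} = ⋃ n : ℕ,
        {x | (sprt f g α β).1 x = (n + 1 : ℕ) ∧ (sprt f g α β).2 x = true} := by
      ext x
      simp only [Set.mem_preimage, Set.mem_singleton_iff, Set.mem_iUnion, Set.mem_ofPred_eq]
      refine ⟨fun hD => ?_, fun ⟨_, _, hD⟩ => hD⟩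
      obtain ⟨n, hn, heq, -⟩ := sprtDecision_eq_true_iff.1 hD
      exact ⟨n - 1, by rwa [Nat.sub_add_cancel hn], hD⟩
    rw [hset]
    exact MeasurableSet.iUnion fun n => obsSigma_le _ _
      (measurableSet_sprtTime_eq_and_sprtDecision hf hg _ _ n.succ_pos true)

namespace AreEquivalentDensities

theorem meanTime_sprt_le (h : AreEquivalentDensities ν f g) (hne : obsLaw ν f ≠ obsLaw ν g)
    {α : ℝ} (hα : α ∈ Set.Ioo (0 : ℝ) 1) (β : ℝ) :
    meanTime (streamLaw ν g) (sprt f g α β) ≤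
      ENNReal.ofReal (√(α⁻¹) / (1 - hellingerAffinity ν f g)) := by
  rw [← exp_half_abs_log hα]
  exact h.lintegral_toENNReal_le_of_logLR_le hne fun x n hn =>
    logLR_le_of_lt_sprtTime (abs_nonneg _) hn

theorem ae_sprtTime_ne_top (h : AreEquivalentDensities ν f g) (hne : obsLaw ν f ≠ obsLaw ν g)
    {α : ℝ} (hα : α ∈ Set.Ioo (0 : ℝ) 1) (β : ℝ) :
    ∀ᵐ x ∂streamLaw ν g, sprtTime f g |Real.log α| |Real.log β| x ≠ ⊤ := by
  have hmeas := (isTest_sprt h.left.measurable h.right.measurable α β).measurable_time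
  filter_upwards [ae_lt_top ((measurable_of_countable _).comp hmeas)
    ((h.meanTime_sprt_le hne hα β).trans_lt ENNReal.ofReal_lt_top).ne] with x hx
  exact ENat.toENNReal_ne_top.1 hx.ne

theorem sprt_mem_testClass (h : AreEquivalentDensities ν f g) (hne : obsLaw ν f ≠ obsLaw ν g)
    {α β : ℝ} (hα : α ∈ Set.Ioo (0 : ℝ) 1) (hβ : β ∈ Set.Ioo (0 : ℝ) 1) :
    sprt f g α β ∈ testClass ν f g α β := by
  have htypeI := h.streamLaw_exists_le_logLR_le |Real.log α|
  have htypeII := h.symm.streamLaw_exists_le_logLR_le |Real.log β|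
  rw [exp_neg_abs_log hα] at htypeI
  rw [exp_neg_abs_log hβ] at htypeII
  refine ⟨isTest_sprt h.left.measurable h.right.measurable α β,
    (measure_mono fun x hD => ?_).trans htypeI, (measure_mono_ae ?_).trans htypeII⟩
  · obtain ⟨n, hn, -, hA⟩ := sprtDecision_eq_true_iff.1 hD
    exact ⟨n, hn, hA⟩
  · filter_upwards [h.ae_sprtTime_ne_top hne hα β] with x hT hD
    obtain ⟨n, hn, hB⟩ := exists_logLR_le_of_sprtDecision_eq_false hD hT
    exact ⟨n, hn, by rw [logLR_swap f g]; exact le_neg_of_le_neg hB⟩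

end AreEquivalentDensities

end SprtTest

/-- The Šidák level `1 - (1 - a)^{1 / d}`: `d` independent tests of this level have familywise
error probability `a`.  The levels `α_m` and `β_m` are its values at `d = m - l_m` and
`d = u_m`. -/
noncomputable def sidakLevel (a d : ℝ) : ℝ :=
  1 - (1 - a) ^ (1 / d)

theorem sidakLevel_mem_Ioo {a d : ℝ} (ha : a ∈ Set.Ioo (0 : ℝ) 1) (hd : 0 < d) :
    sidakLevel a d ∈ Set.Ioo (0 : ℝ) 1 := by
  have hpos : 0 < (1 - a) ^ (1 / d) := Real.rpow_pos_of_pos (sub_pos.2 ha.2) _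
  have hlt : (1 - a) ^ (1 / d) < 1 :=
    Real.rpow_lt_one (sub_pos.2 ha.2).le (by linarith [ha.1]) (one_div_pos.2 hd)
  exact ⟨sub_pos.2 hlt, sub_lt_self _ hpos⟩

theorem div_le_sidakLevel {a d : ℝ} (ha : a ≤ 1) (hd : 1 ≤ d) : a / d ≤ sidakLevel a d := by
  have hbernoulli := rpow_one_add_le_one_add_mul_self (s := -a) (neg_le_neg ha)
    (p := 1 / d) (by positivity) ((div_le_one (by linarith)).2 hd)
  rw [sidakLevel, sub_eq_add_neg 1 a]
  linarith [show 1 / d * -a = -(a / d) by ring]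

theorem exists_sidakLevel_eq {a d : ℝ} (ha : a ∈ Set.Ioo (0 : ℝ) 1) (hd : 0 < d) :
    ∃ b ∈ Set.Ioo (0 : ℝ) 1, sidakLevel b d = a := by
  have hpos : 0 < 1 - a := sub_pos.2 ha.2
  refine ⟨sidakLevel a d⁻¹, sidakLevel_mem_Ioo ha (inv_pos.2 hd), ?_⟩
  rw [sidakLevel, sidakLevel, sub_sub_cancel, one_div, one_div, inv_inv,
    Real.rpow_rpow_inv hpos.le hd.ne', sub_sub_cancel]

theorem tendsto_sqrt_inv_div {ι : Type*} {L : Filter ι} {c : ℝ} (hc : 0 < c) {a d : ι → ℝ}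
    (hd : Tendsto d L atTop) (ha : ∀ k, c / d k ≤ a k) :
    Tendsto (fun k => √((a k)⁻¹) / d k) L (𝓝 0) := by
  have hlim : Tendsto (fun k => √(c⁻¹) / √(d k)) L (𝓝 0) :=
    Tendsto.const_div_atTop (Real.tendsto_sqrt_atTop.comp hd) _
  refine squeeze_zero' ?_ ?_ hlim <;> filter_upwards [hd.eventually_gt_atTop 0] with k hk
  · positivity
  · have hinv : (a k)⁻¹ ≤ c⁻¹ * d k := by
      rw [← div_eq_inv_mul, ← inv_div]
      exact inv_anti₀ (by positivity) (ha k)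
    calc √((a k)⁻¹) / d k ≤ √(c⁻¹ * d k) / d k := by gcongr
      _ = √(c⁻¹) / √(d k) := by
        rw [Real.sqrt_mul (by positivity), mul_div_assoc, Real.sqrt_div_self, ← div_eq_mul_inv]

theorem asympLE_of_mul_le_mul_mul_add {w x y e R : ℕ → ℝ≥0∞} (hy : ∀ k, 1 ≤ y k)
    (hR : Tendsto R atTop (𝓝 1)) (hw : Tendsto w atTop (𝓝 1)) (he : Tendsto e atTop (𝓝 0))
    (h : ∀ᶠ k in atTop, w k * x k ≤ R k * (w k * y k + e k)) : AsympLE x y := by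
  have hlim : Tendsto (fun k => R k * (w k + e k) / w k) atTop (𝓝 1) := by
    have hwe : Tendsto (fun k => w k + e k) atTop (𝓝 1) := by simpa using hw.add he
    have hnum := ENNReal.Tendsto.mul hR (Or.inl one_ne_zero) hwe (Or.inl one_ne_zero)
    simpa using ENNReal.Tendsto.div hnum (Or.inl (by simp)) hw (Or.inl ENNReal.one_ne_top)
  refine (limsup_le_limsup ?_).trans hlim.limsup_eq.le
  filter_upwards [h, hw.eventually_ne one_ne_zero, hw.eventually_ne ENNReal.one_ne_top]
    with k hk hw0 hwtop
  have habsorb : w k * x k ≤ R k * (w k + e k) * y k :=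
    calc w k * x k ≤ R k * (w k * y k + e k) := hk
      _ ≤ R k * (w k * y k + e k * y k) := by gcongr; exact le_mul_of_one_le_right' (hy k)
      _ = R k * (w k + e k) * y k := by ring
  refine ENNReal.div_le_of_le_mul ?_
  rw [← ENNReal.mul_div_right_comm, ENNReal.le_div_iff_mul_le (Or.inl hw0) (Or.inl hwtop),
    mul_comm]
  exact habsorb

theorem exists_strictMono_const_of_not_tendsto {w : ℕ → ℕ} (h : ¬ Tendsto w atTop atTop) :
    ∃ v, ∃ mk : ℕ → ℕ, StrictMono mk ∧ (∀ k, 1 ≤ mk k) ∧ ∀ k, w (mk k) = v := by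
  simp only [tendsto_atTop, not_forall, not_eventually, not_le] at h
  obtain ⟨b, hb⟩ := h
  have hfreq : ∃ᶠ m in atTop, ∃ v ∈ Finset.range b, w m = v :=
    hb.mono fun m hm => ⟨w m, Finset.mem_range.2 hm, rfl⟩
  obtain ⟨v, -, hv⟩ := (Finset.frequently_exists _).1 hfreq
  obtain ⟨mk, hmk, hP⟩ :=
    extraction_of_frequently_atTop (hv.and_eventually (eventually_ge_atTop 1))
  exact ⟨v, mk, hmk, fun k => (hP k).2, fun k => (hP k).1⟩

section Asymptotics

variable {S : Type*} [MeasurableSpace S] {ν : Measure S} {f g : S → ℝ}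

namespace AreEquivalentDensities

theorem meanTime_mixLaw_le_of_div_optTime_le (h : AreEquivalentDensities ν f g)
    (hne : obsLaw ν f ≠ obsLaw ν g) {α β : ℝ} (hα : α ∈ Set.Ioo (0 : ℝ) 1)
    (hβ : β ∈ Set.Ioo (0 : ℝ) 1) {p : ℝ} {E R : ℝ≥0∞} (hE : E / optTime ν f g p α β ≤ R)
    (hR : R ≠ 0) (hRtop : R ≠ ⊤) : E ≤ R * meanTime (mixLaw ν f g p) (sprt f g α β) := by
  have hopt : optTime ν f g p α β ≤ meanTime (mixLaw ν f g p) (sprt f g α β) :=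
    iInf₂_le _ (h.sprt_mem_testClass hne hα hβ)
  rw [← ENNReal.div_le_iff_le_mul (Or.inr hRtop) (Or.inr hR)]
  exact (ENNReal.div_le_div_left hopt _).trans hE

theorem tendsto_weight_mul_meanTime_sprt (h : AreEquivalentDensities ν f g)
    (hne : obsLaw ν f ≠ obsLaw ν g) {ι : Type*} {L : Filter ι} {c : ℝ} (hc : 0 < c) {a d : ι → ℝ}
    (hd : Tendsto d L atTop) (ha : ∀ k, a k ∈ Set.Ioo (0 : ℝ) 1) (hda : ∀ k, c / d k ≤ a k)
    (v β : ℝ) :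
    Tendsto (fun k => ENNReal.ofReal (v / d k) * meanTime (streamLaw ν g) (sprt f g (a k) β))
      L (𝓝 0) := by
  have hden : 0 < 1 - hellingerAffinity ν f g := sub_pos.2 (h.hellingerAffinity_lt_one hne)
  have hlim : Tendsto (fun k => ENNReal.ofReal
      (v / (1 - hellingerAffinity ν f g) * (√((a k)⁻¹) / d k))) L (𝓝 0) := by
    simpa using ENNReal.tendsto_ofReal ((tendsto_sqrt_inv_div hc hd hda).const_mul
      (v / (1 - hellingerAffinity ν f g)))
  refine tendsto_of_tendsto_of_tendsto_of_le_of_le tendsto_const_nhds hlim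
    (fun k => zero_le) fun k => ?_
  calc ENNReal.ofReal (v / d k) * meanTime (streamLaw ν g) (sprt f g (a k) β)
      ≤ ENNReal.ofReal (v / d k) *
          ENNReal.ofReal (√((a k)⁻¹) / (1 - hellingerAffinity ν f g)) := by
        gcongr
        exact h.meanTime_sprt_le hne (ha k) β
    _ = ENNReal.ofReal (v / (1 - hellingerAffinity ν f g) * (√((a k)⁻¹) / d k)) := by
        rw [← ENNReal.ofReal_mul' (by positivity), div_mul_div_comm, div_mul_div_comm,
          mul_comm (d k)]

theorem asympLE_of_meanTime_mixLaw_le (h : AreEquivalentDensities ν f g)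
    (hne : obsLaw ν f ≠ obsLaw ν g) {c v β : ℝ} (hc : 0 < c) {a d : ℕ → ℝ}
    (hd : Tendsto d atTop atTop) (ha : ∀ k, a k ∈ Set.Ioo (0 : ℝ) 1) (hda : ∀ k, c / d k ≤ a k)
    {τ : ℕ → TimeDecision S} {R : ℕ → ℝ≥0∞} (hR : Tendsto R atTop (𝓝 1))
    (hle : ∀ᶠ k in atTop, meanTime (mixLaw ν f g (v / d k)) (τ k) ≤
      R k * meanTime (mixLaw ν f g (v / d k)) (sprt f g (a k) β)) :
    AsympLE (fun k => meanTime (streamLaw ν f) (τ k))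
      (fun k => meanTime (streamLaw ν f) (sprt f g (a k) β)) := by
  have := h.left.isProbabilityMeasure_streamLaw
  have hweight : Tendsto (fun k => ENNReal.ofReal (1 - v / d k)) atTop (𝓝 1) := by
    simpa using ENNReal.tendsto_ofReal
      ((tendsto_const_nhds (x := (1 : ℝ))).sub (hd.const_div_atTop v))
  refine asympLE_of_mul_le_mul_mul_add
    (fun k => one_le_meanTime _ (isTest_sprt h.left.measurable h.right.measurable _ _))
    hR hweight (h.tendsto_weight_mul_meanTime_sprt hne hc hd ha hda v β) ?_
  filter_upwards [hle] with k hk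
  rw [meanTime_mixLaw, meanTime_mixLaw] at hk
  exact le_self_add.trans hk

variable {l u : ℕ → ℕ} {χ : ℝ → ℝ → TimeDecision S}

theorem exists_eventually_meanTime_mixLaw_le (h : AreEquivalentDensities ν f g)
    (hne : obsLaw ν f ≠ obsLaw ν g) (hl : ∀ m : ℕ, 1 ≤ m → l m < m)
    (hu : ∀ m : ℕ, 1 ≤ m → 0 < u m) (hopt : IsAsympOptimalHD ν f g l u χ) {α β : ℝ}
    (hα : α ∈ Set.Ioo (0 : ℝ) 1) (hβ : β ∈ Set.Ioo (0 : ℝ) 1) :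
    ∃ R : ℕ → ℝ≥0∞, Tendsto R atTop (𝓝 1) ∧ ∀ᶠ m : ℕ in atTop, ∀ s ∈ Finset.Icc (l m) (u m),
      meanTime (mixLaw ν f g (s / m)) (χ (alphaLevel l α m) (betaLevel u β m)) ≤
        R m * meanTime (mixLaw ν f g (s / m)) (sprt f g (alphaLevel l α m) (betaLevel u β m)) := by
  refine ⟨_, hopt α hα β hβ, ?_⟩
  filter_upwards [eventually_ge_atTop 1, (hopt α hα β hβ).eventually_ne one_ne_zero,
    (hopt α hα β hβ).eventually_ne ENNReal.one_ne_top] with m hm hR hRtop s hs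
  refine h.meanTime_mixLaw_le_of_div_optTime_le hne
    (sidakLevel_mem_Ioo hα (sub_pos.2 (Nat.cast_lt.2 (hl m hm))))
    (sidakLevel_mem_Ioo hβ (Nat.cast_pos.2 (hu m hm))) ?_ hR hRtop
  exact le_iSup₂ (f := fun s (_ : s ∈ Finset.Icc (l m) (u m)) =>
    meanTime (mixLaw ν f g ((s : ℝ) / (m : ℝ))) (χ (alphaLevel l α m) (betaLevel u β m)) /
      optTime ν f g ((s : ℝ) / (m : ℝ)) (alphaLevel l α m) (betaLevel u β m)) s hs

theorem asympLE_meanTime_alphaLevel (h : AreEquivalentDensities ν f g)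
    (hne : obsLaw ν f ≠ obsLaw ν g)
    (hlu : ∀ m : ℕ, 1 ≤ m → l m ≤ u m ∧ u m ≤ m ∧ 0 < u m ∧ l m < m)
    (hopt : IsAsympOptimalHD ν f g l u χ) {v : ℕ} {mk : ℕ → ℕ} (hmk : Tendsto mk atTop atTop)
    (hmk1 : ∀ k, 1 ≤ mk k) (hv : ∀ k, u (mk k) = v) {α β : ℝ}
    (hα : α ∈ Set.Ioo (0 : ℝ) 1) (hβ : β ∈ Set.Ioo (0 : ℝ) 1) :
    AsympLE (fun k => meanTime (streamLaw ν f) (χ (alphaLevel l α (mk k)) β))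
      (fun k => meanTime (streamLaw ν f) (sprt f g (alphaLevel l α (mk k)) β)) := by
  have hv_pos : (0 : ℝ) < v := Nat.cast_pos.2 (hv 0 ▸ (hlu _ (hmk1 0)).2.2.1)
  obtain ⟨b, hb, hbβ⟩ := exists_sidakLevel_eq hβ hv_pos
  have hβ_level : ∀ k, betaLevel u b (mk k) = β := fun k => by rw [betaLevel, hv, ← hbβ, sidakLevel]
  have hgap : ∀ k, (1 : ℝ) ≤ (mk k : ℝ) - l (mk k) := fun k => by
    rw [← Nat.cast_sub (hlu _ (hmk1 k)).2.2.2.le, Nat.one_le_cast]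
    exact Nat.sub_pos_of_lt (hlu _ (hmk1 k)).2.2.2
  obtain ⟨R, hR, hle⟩ := h.exists_eventually_meanTime_mixLaw_le hne
    (fun m hm => (hlu m hm).2.2.2) (fun m hm => (hlu m hm).2.2.1) hopt hα hb
  refine h.asympLE_of_meanTime_mixLaw_le hne hα.1 (v := v)
    (tendsto_natCast_atTop_atTop.comp hmk)
    (fun k => sidakLevel_mem_Ioo hα (one_pos.trans_le (hgap k))) (fun k => ?_)
    (hR.comp hmk) ?_
  · exact (div_le_div_of_nonneg_left hα.1.le (one_pos.trans_le (hgap k))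
      (sub_le_self _ (Nat.cast_nonneg _))).trans (div_le_sidakLevel hα.2.le (hgap k))
  · filter_upwards [hmk.eventually hle] with k hk
    have hat_u := hk (u (mk k)) (Finset.right_mem_Icc.2 (hlu _ (hmk1 k)).1)
    rwa [hβ_level, hv] at hat_u

theorem asympLE_meanTime_betaLevel (h : AreEquivalentDensities ν f g)
    (hne : obsLaw ν f ≠ obsLaw ν g)
    (hlu : ∀ m : ℕ, 1 ≤ m → l m ≤ u m ∧ u m ≤ m ∧ 0 < u m ∧ l m < m)
    (hopt : IsAsympOptimalHD ν f g l u χ) {v : ℕ} {mk : ℕ → ℕ} (hmk : Tendsto mk atTop atTop)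
    (hmk1 : ∀ k, 1 ≤ mk k) (hv : ∀ k, mk k - l (mk k) = v) {α β : ℝ}
    (hα : α ∈ Set.Ioo (0 : ℝ) 1) (hβ : β ∈ Set.Ioo (0 : ℝ) 1) :
    AsympLE (fun k => meanTime (streamLaw ν g) (χ α (betaLevel u β (mk k))))
      (fun k => meanTime (streamLaw ν g) (sprt f g α (betaLevel u β (mk k)))) := by
  have hgap : ∀ k, (mk k : ℝ) - l (mk k) = v := fun k => by
    rw [← hv k, Nat.cast_sub (hlu _ (hmk1 k)).2.2.2.le]
  have hv_pos : (0 : ℝ) < v :=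
    hgap 0 ▸ sub_pos.2 (Nat.cast_lt.2 (hlu _ (hmk1 0)).2.2.2)
  obtain ⟨a, ha, haα⟩ := exists_sidakLevel_eq hα hv_pos
  have hα_level : ∀ k, alphaLevel l a (mk k) = α := fun k => by
    rw [alphaLevel, hgap, ← haα, sidakLevel]
  have hu : ∀ k, (1 : ℝ) ≤ u (mk k) := fun k => Nat.one_le_cast.2 (hlu _ (hmk1 k)).2.2.1
  have hweight : ∀ k, 1 - (v : ℝ) / mk k = l (mk k) / mk k := fun k => by
    have hmk_pos : (0 : ℝ) < mk k := Nat.cast_pos.2 (hmk1 k)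
    rw [← hgap k, one_sub_div hmk_pos.ne', sub_sub_cancel]
  obtain ⟨R, hR, hle⟩ := h.exists_eventually_meanTime_mixLaw_le hne
    (fun m hm => (hlu m hm).2.2.2) (fun m hm => (hlu m hm).2.2.1) hopt ha hβ
  simp only [← meanTime_sprt_swap _ f g α]
  refine h.symm.asympLE_of_meanTime_mixLaw_le hne.symm hβ.1 (v := v)
    (a := fun k => betaLevel u β (mk k)) (tendsto_natCast_atTop_atTop.comp hmk)
    (fun k => sidakLevel_mem_Ioo hβ (one_pos.trans_le (hu k))) (fun k => ?_)
    (hR.comp hmk) ?_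
  · exact (div_le_div_of_nonneg_left hβ.1.le (one_pos.trans_le (hu k))
      (Nat.cast_le.2 (hlu _ (hmk1 k)).2.1)).trans (div_le_sidakLevel hβ.2.le (hu k))
  · filter_upwards [hmk.eventually hle] with k hk
    have hat_l := hk (l (mk k)) (Finset.left_mem_Icc.2 (hlu _ (hmk1 k)).1)
    rw [hα_level] at hat_l
    simpa only [Function.comp_apply, mixLaw_swap ν f g, hweight, meanTime_sprt_swap _ f g α]
      using hat_l

end AreEquivalentDensities

theorem IsDensity.obsLaw_ne_of_klInfo_pos (hf : IsDensity ν f) (hpos : 0 < klInfo ν f g) :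
    obsLaw ν f ≠ obsLaw ν g := fun heq => by
  have := hf.isProbabilityMeasure_obsLaw
  rw [klInfo, ← heq, InformationTheory.klDiv_self] at hpos
  exact hpos.false

end Asymptotics

end SharpSPRT

theorem mainTheorem6_general {S : Type*} [MeasurableSpace S] (ν : Measure S)
    (f₀ f₁ : S → ℝ) (hf₀ : SharpSPRT.IsDensity ν f₀) (hf₁ : SharpSPRT.IsDensity ν f₁)
    (hac : SharpSPRT.obsLaw ν f₀ ≪ SharpSPRT.obsLaw ν f₁)
    (hac' : SharpSPRT.obsLaw ν f₁ ≪ SharpSPRT.obsLaw ν f₀)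
    (hne : SharpSPRT.obsLaw ν f₀ ≠ SharpSPRT.obsLaw ν f₁)
    (l u : ℕ → ℕ)
    (hlu : ∀ m : ℕ, 1 ≤ m → l m ≤ u m ∧ u m ≤ m ∧ 0 < u m ∧ l m < m)
    (χ : ℝ → ℝ → SharpSPRT.TimeDecision S) (hopt : SharpSPRT.IsAsympOptimalHD ν f₀ f₁ l u χ) :
    (¬ Tendsto u atTop atTop →
      ∃ mk : ℕ → ℕ, StrictMono mk ∧ (∀ k, 1 ≤ mk k) ∧
        ∀ α ∈ Set.Ioo (0 : ℝ) 1, ∀ β ∈ Set.Ioo (0 : ℝ) 1,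
          SharpSPRT.AsympLE
            (fun k => SharpSPRT.meanTime (SharpSPRT.streamLaw ν f₀)
              (χ (SharpSPRT.alphaLevel l α (mk k)) β))
            (fun k => SharpSPRT.meanTime (SharpSPRT.streamLaw ν f₀)
              (SharpSPRT.sprt f₀ f₁ (SharpSPRT.alphaLevel l α (mk k)) β))) ∧
    (¬ Tendsto (fun m => m - l m) atTop atTop →
      ∃ mk : ℕ → ℕ, StrictMono mk ∧ (∀ k, 1 ≤ mk k) ∧
        ∀ α ∈ Set.Ioo (0 : ℝ) 1, ∀ β ∈ Set.Ioo (0 : ℝ) 1,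
          SharpSPRT.AsympLE
            (fun k => SharpSPRT.meanTime (SharpSPRT.streamLaw ν f₁)
              (χ α (SharpSPRT.betaLevel u β (mk k))))
            (fun k => SharpSPRT.meanTime (SharpSPRT.streamLaw ν f₁)
              (SharpSPRT.sprt f₀ f₁ α (SharpSPRT.betaLevel u β (mk k))))) := by
  have h : SharpSPRT.AreEquivalentDensities ν f₀ f₁ := ⟨hf₀, hf₁, hac, hac'⟩
  refine ⟨fun hu => ?_, fun hl => ?_⟩
  · obtain ⟨v, mk, hmk, hmk1, hv⟩ := SharpSPRT.exists_strictMono_const_of_not_tendsto hu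
    exact ⟨mk, hmk, hmk1, fun α hα β hβ =>
      h.asympLE_meanTime_alphaLevel hne hlu hopt hmk.tendsto_atTop hmk1 hv hα hβ⟩
  · obtain ⟨v, mk, hmk, hmk1, hv⟩ := SharpSPRT.exists_strictMono_const_of_not_tendsto hl
    exact ⟨mk, hmk, hmk1, fun α hα β hβ =>
      h.asympLE_meanTime_betaLevel hne hlu hopt hmk.tendsto_atTop hmk1 hv hα hβ⟩

theorem mainTheorem6 {S : Type*} [MeasurableSpace S] (ν : Measure S) [SigmaFinite ν]
    (f₀ f₁ : S → ℝ) (hf₀ : SharpSPRT.IsDensity ν f₀) (hf₁ : SharpSPRT.IsDensity ν f₁)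
    (hI₀ : SharpSPRT.klInfo ν f₀ f₁ ∈ Set.Ioo (0 : ℝ≥0∞) ⊤)
    (hI₁ : SharpSPRT.klInfo ν f₁ f₀ ∈ Set.Ioo (0 : ℝ≥0∞) ⊤)
    (l u : ℕ → ℕ)
    (hlu : ∀ m : ℕ, 1 ≤ m → l m ≤ u m ∧ u m ≤ m ∧ 0 < u m ∧ l m < m)
    (χ : ℝ → ℝ → SharpSPRT.TimeDecision S) (hχ : SharpSPRT.IsTestFamily ν f₀ f₁ χ)
    (hopt : SharpSPRT.IsAsympOptimalHD ν f₀ f₁ l u χ) :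
    (¬ Tendsto u atTop atTop →
      ∃ mk : ℕ → ℕ, StrictMono mk ∧ (∀ k, 1 ≤ mk k) ∧
        ∀ α ∈ Set.Ioo (0 : ℝ) 1, ∀ β ∈ Set.Ioo (0 : ℝ) 1,
          SharpSPRT.AsympLE
            (fun k => SharpSPRT.meanTime (SharpSPRT.streamLaw ν f₀)
              (χ (SharpSPRT.alphaLevel l α (mk k)) β))
            (fun k => SharpSPRT.meanTime (SharpSPRT.streamLaw ν f₀)
              (SharpSPRT.sprt f₀ f₁ (SharpSPRT.alphaLevel l α (mk k)) β))) ∧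
    (¬ Tendsto (fun m => m - l m) atTop atTop →
      ∃ mk : ℕ → ℕ, StrictMono mk ∧ (∀ k, 1 ≤ mk k) ∧
        ∀ α ∈ Set.Ioo (0 : ℝ) 1, ∀ β ∈ Set.Ioo (0 : ℝ) 1,
          SharpSPRT.AsympLE
            (fun k => SharpSPRT.meanTime (SharpSPRT.streamLaw ν f₁)
              (χ α (SharpSPRT.betaLevel u β (mk k))))
            (fun k => SharpSPRT.meanTime (SharpSPRT.streamLaw ν f₁)
              (SharpSPRT.sprt f₀ f₁ α (SharpSPRT.betaLevel u β (mk k))))) :=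
  mainTheorem6_general ν f₀ f₁ hf₀ hf₁ (InformationTheory.klDiv_ne_top_iff.1 hI₀.2.ne).1
    (InformationTheory.klDiv_ne_top_iff.1 hI₁.2.ne).1 (hf₀.obsLaw_ne_of_klInfo_pos hI₀.1)
    l u hlu χ hopt
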